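/- Let $\tau>0$ be a real number such that $1/\tau$ is a positive integer, and let $G$ be a finite simple connected graph of order $n\ge 4\tau+\frac1\tau+5$. For a connected graph $H$ let $\lambda_1(D(H))$ be the largest eigenvalue of its distance matrix $D(H)=(d_H(u,v))_{u,v\in V(H)}$. For $S\subseteq V(G)$ let $c(G-S)$ be the number of connected components of $G-S$, and put $$\tau(G)=\min_{S\subseteq V(G)}\left\{\frac{|S|}{c(G-S)-1}: c(G-S)>1\right\},$$ with $\tau(G)=+\infty$ if $G$ is complete; $G$ is called $\tau$-tough if $\tau(G)\ge\tau$. Let $G^*=K_1\vee\left(K_{n-\frac1\tau-2}\cup\left(\frac1\tau+1\right)K_1\right)$, where $\cup$ denotes the disjoint union, $\vee$ the join of graphs, and $mK_1$ the graph with $m$ vertices and no edges. If $\lambda_1(D(G))\le\lambda_1(D(G^*))$, then $G$ is $\tau$-tough, unless $G\cong G^*$, in which case $G$ is not $\tau$-tough. -/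

import Mathlib

namespace DistTough

noncomputable section

/-- The distance matrix of a graph: its `(u, v)` entry is the distance between `u` and `v`. -/
def distMatrix {V : Type*} (G : SimpleGraph V) : Matrix V V ℝ :=
  Matrix.of fun u v => (G.dist u v : ℝ)

theorem isHermitian_distMatrix {V : Type*} (G : SimpleGraph V) :
    (distMatrix G).IsHermitian := by
  ext u v
  simp [distMatrix, SimpleGraph.dist_comm]

/-- The distance spectral radius: the largest eigenvalue of the distance matrix. -/
def distLambdaOne {V : Type*} [Fintype V] [DecidableEq V] (G : SimpleGraph V) : ℝ :=
  ⨆ i, (isHermitian_distMatrix G).eigenvalues i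

/-- The number of connected components of `G - S`. -/
def numComponentsDelete {V : Type*} (G : SimpleGraph V) (S : Finset V) : ℕ :=
  Nat.card (G.induce ((S : Set V)ᶜ)).ConnectedComponent

/-- The variation of toughness
`min { |S| / (c(G - S) - 1) : S ⊆ V(G), c(G - S) > 1 }`.
It is `⊤` if no set `S` is admissible, that is, if `G` is complete. -/
def toughnessVariation {V : Type*} (G : SimpleGraph V) : EReal :=
  ⨅ (S : Finset V) (_ : 1 < numComponentsDelete G S),
    (((S.card : ℝ) / ((numComponentsDelete G S : ℝ) - 1) : ℝ) : EReal)

/-- `G` is `τ`-tough. -/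
def IsTough {V : Type*} (G : SimpleGraph V) (τ : ℝ) : Prop :=
  (τ : EReal) ≤ toughnessVariation G

/-- The join of two vertex-disjoint graphs: their disjoint union together with
all edges between the two parts. -/
def join {V W : Type*} (G : SimpleGraph V) (H : SimpleGraph W) : SimpleGraph (V ⊕ W) :=
  SimpleGraph.sum G H ⊔ completeBipartiteGraph V W

/-- The graph `K₁ ∨ (K_{n-k-2} ∪ (k+1) K₁)`, which has `n` vertices if `n ≥ k + 2`. -/
def extremalGraph (n k : ℕ) : SimpleGraph (Fin 1 ⊕ (Fin (n - k - 2) ⊕ Fin (k + 1))) :=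
  join (⊤ : SimpleGraph (Fin 1))
    (SimpleGraph.sum (⊤ : SimpleGraph (Fin (n - k - 2))) (⊥ : SimpleGraph (Fin (k + 1))))

end

end DistTough

/-! Put `k = 1/τ`. If `G` is not `τ`-tough, integrality gives a set `S` of size `s` with at least `k
s + 2` components in `G - S`. Merge these into `p + 1` classes, where `p = k s + 1`. Moving all
vertices outside `S` into a largest class, except one representative of each other class, and adding
all permitted edges gives `H = K_s ∨ (K_m ∪ p K₁)`. By `exists_threeClass_of_coloring`, the distance
form of `H` at its positive eigenvector is strictly below that of `G`, unless the distance matrices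
agree. Hence `λ₁(D(G)) ≥ λ₁(D(H))`, with equality only for `G = H`.

The quotient of `D(H)` by the three vertex classes has a cubic characteristic polynomial. A
sufficiently large root carries a positive eigenvector, so it is the spectral radius. For `s = 1`
the graph `H` is `G*`, with root `x`. For `s ≥ 2`, `cubicDifference_neg` makes the cubic negative at
`x`, so it has a root beyond `x`. Thus `λ₁(D(G)) ≤ λ₁(D(G*))` leaves only `G ≅ G*`. Conversely,
deleting the centre of `G*` leaves `k + 2` components. -/

namespace DistTough

/-! ### Roots and eigenvectors of the quotient cubic -/

/-- The characteristic polynomial of the quotient of the distance matrix of the graph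
`K_s ∨ (K_m ∪ p K₁)` by its three obvious classes of vertices. -/
def quotientCubic (s m p x : ℝ) : ℝ :=
  x ^ 3 - (s + m + 2 * p - 4) * x ^ 2
    + (5 - 3 * (s + m + p) - p + 3 * s * p - 2 * (s + m + p) * p + 2 * p ^ 2) * x
    - (2 * (s + m - 1) + p * (m + 1) * (2 - s))

theorem exists_root_gt_of_cubic_neg {a b c t : ℝ}
    (h : t ^ 3 + a * t ^ 2 + b * t + c < 0) :
    ∃ x, t < x ∧ x ^ 3 + a * x ^ 2 + b * x + c = 0 := by
  -- Large enough for the cubic term to dominate, which gives the sign change for the intermediate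
  -- value theorem.
  set X : ℝ := 1 + |t| + |a| + |b| + |c| with hX
  have ht := le_abs_self t
  have ha := neg_abs_le a
  have hb := neg_abs_le b
  have hc := neg_abs_le c
  have ha0 := abs_nonneg a
  have hb0 := abs_nonneg b
  have hc0 := abs_nonneg c
  have ht0 := abs_nonneg t
  have hX1 : 1 ≤ X := by linarith
  have hpos : 0 < X ^ 3 + a * X ^ 2 + b * X + c := by
    have hX2 : X ≤ X ^ 2 := by nlinarith
    have h2 : 0 < X ^ 2 := by positivity
    have e1 : -(|a| * X ^ 2) ≤ a * X ^ 2 := by nlinarith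
    have e2 : -(|b| * X ^ 2) ≤ b * X := by
      have : -(|b| * X) ≤ b * X := by nlinarith
      have : |b| * X ≤ |b| * X ^ 2 := by gcongr
      linarith
    have e3 : -(|c| * X ^ 2) ≤ c := by
      have : |c| * 1 ≤ |c| * X ^ 2 := by gcongr; linarith
      linarith
    have e4 : X ^ 3 = X ^ 2 + |t| * X ^ 2 + |a| * X ^ 2 + |b| * X ^ 2 + |c| * X ^ 2 := by
      have : X ^ 3 = X ^ 2 * X := by ring
      rw [this]
      nth_rewrite 2 [hX]
      ring
    have e5 : 0 ≤ |t| * X ^ 2 := by positivity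
    linarith
  have hcont : ContinuousOn (fun x : ℝ => x ^ 3 + a * x ^ 2 + b * x + c) (Set.Icc t X) := by
    fun_prop
  have htX : t ≤ X := by linarith
  obtain ⟨x, hx, hx0⟩ := intermediate_value_Icc htX hcont ⟨h.le, hpos.le⟩
  refine ⟨x, lt_of_le_of_ne hx.1 ?_, hx0⟩
  rintro rfl
  exact h.ne hx0

theorem exists_root_gt_of_quotientCubic_neg {s m p t : ℝ} (h : quotientCubic s m p t < 0) :
    ∃ x, t < x ∧ quotientCubic s m p x = 0 := by
  obtain ⟨x, hx, hx0⟩ := exists_root_gt_of_cubic_neg (a := -(s + m + 2 * p - 4))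
    (b := 5 - 3 * (s + m + p) - p + 3 * s * p - 2 * (s + m + p) * p + 2 * p ^ 2)
    (c := -(2 * (s + m - 1) + p * (m + 1) * (2 - s))) (t := t)
    (by rw [quotientCubic] at h; linarith)
  exact ⟨x, hx, by rw [quotientCubic]; linarith⟩

theorem exists_pos_eigenvector_of_quotientCubic_eq_zero {s m p x : ℝ} (hm : 0 < m) (hp : 0 < p)
    (hx0 : 0 < x) (hxs : s - 1 < x) (hxm : m - 3 < x) (h : quotientCubic s m p x = 0) :
    ∃ a b c : ℝ, 0 < a ∧ 0 < b ∧ 0 < c ∧ c < 2 * b ∧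
      (s - 1) * a + m * b + p * c = x * a ∧
      s * a + (m - 1) * b + 2 * p * c = x * b ∧
      s * a + 2 * m * b + 2 * (p - 1) * c = x * c := by
  -- Differences of consecutive rows give `(x + 1)(b - a) = p c` and `(x + 2) c = (x + m + 1) b`.
  -- This fixes the vector up to scale, and the first row then becomes the cubic equation.
  set a := (x + 2) * (x + 1) - p * (x + m + 1) with ha
  set b := (x + 2) * (x + 1) with hb
  set c := (x + m + 1) * (x + 1) with hc
  have hb0 : 0 < b := by positivity
  have hc0 : 0 < c := by positivity
  have row : (s - 1) * a + m * b + p * c = x * a := by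
    rw [quotientCubic] at h
    rw [ha, hb, hc]
    linear_combination -h
  have ha0 : 0 < a := by
    have : 0 < (x - (s - 1)) * a := by
      have : 0 < m * b + p * c := by positivity
      linarith
    exact pos_of_mul_pos_right this (by linarith)
  refine ⟨a, b, c, ha0, hb0, hc0, by rw [hb, hc]; nlinarith, row, ?_, ?_⟩
  · have : x * (b - a) = a - b + p * c := by rw [ha, hb, hc]; ring
    linarith
  · have h1 : x * (b - a) = a - b + p * c := by rw [ha, hb, hc]; ring
    have h2 : x * (c - b) = (m + 1) * b - 2 * c := by rw [hb, hc]; ring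
    linarith

theorem le_of_four_div_add_le {k n : ℕ} (hk : 1 ≤ k) (hn : 4 / (k : ℝ) + k + 5 ≤ n) :
    k + 6 ≤ n ∧ (k = 1 → 10 ≤ n) ∧ (k = 2 → 9 ≤ n) ∧ (k = 3 → 10 ≤ n) := by
  have hk0 : (0 : ℝ) < k := by exact_mod_cast hk
  have h4 : 0 < 4 / (k : ℝ) := by positivity
  refine ⟨?_, ?_, ?_, ?_⟩
  · have : ((k + 5 : ℕ) : ℝ) < n := by push_cast; linarith
    have : k + 5 < n := by exact_mod_cast this
    omega
  · rintro rfl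
    have : ((10 : ℕ) : ℝ) ≤ n := by push_cast at hn ⊢; linarith
    exact_mod_cast this
  · rintro rfl
    have : ((9 : ℕ) : ℝ) ≤ n := by push_cast at hn ⊢; linarith
    exact_mod_cast this
  · rintro rfl
    have : ((9 : ℕ) : ℝ) < n := by push_cast at hn ⊢; linarith
    have : 9 < n := by exact_mod_cast this
    omega

/-- Provides a root beyond the explicit point `n + k + 5/4`, the lower bound on `x` used in
`cubicDifference_neg`. -/
theorem quotientCubic_one_neg {k n : ℕ} (hk : 1 ≤ k) (hn : 4 / (k : ℝ) + k + 5 ≤ n) :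
    quotientCubic 1 ((n : ℝ) - k - 2) (k + 1) (n + k + 5 / 4) < 0 := by
  obtain ⟨h0, h1, h2, h3⟩ := le_of_four_div_add_le hk hn
  have key : ∀ k' n' : ℝ, quotientCubic 1 (n' - k' - 2) (k' + 1) (n' + k' + 5 / 4) =
      (n' + k' + 5 / 4) * (2 * k' ^ 2 + 41 / 4 * k' + 229 / 16 - (2 * k' + 3 / 4) * n')
        - (2 * (n' - k' - 2) + (k' + 1) * (n' - k' - 1)) := by
    intro k' n'
    rw [quotientCubic]
    ring
  rw [key]
  have hkn : (k : ℝ) + 6 ≤ n := by exact_mod_cast h0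
  have hk0 : (1 : ℝ) ≤ k := by exact_mod_cast hk
  -- For `k ≥ 4` the first bracket is already negative once `n ≥ k + 6`. Smaller `k` need the
  -- sharper bounds; at `k = 2`, `n = 9` the bracket is positive and the last term decides.
  obtain rfl | rfl | rfl | hk4 : k = 1 ∨ k = 2 ∨ k = 3 ∨ 4 ≤ k := by omega
  · have : (10 : ℝ) ≤ n := by exact_mod_cast h1 rfl
    push_cast
    nlinarith
  · have : (9 : ℝ) ≤ n := by exact_mod_cast h2 rfl
    push_cast
    nlinarith
  · have : (10 : ℝ) ≤ n := by exact_mod_cast h3 rfl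
    push_cast
    nlinarith
  · have hk4' : (4 : ℝ) ≤ k := by exact_mod_cast hk4
    have e1 : 2 * (k : ℝ) ^ 2 + 41 / 4 * k + 229 / 16 - (2 * k + 3 / 4) * n < 0 := by nlinarith
    have e2 : (0 : ℝ) < n + k + 5 / 4 := by positivity
    have e3 : (0 : ℝ) < 2 * (n - k - 2) + (k + 1) * (n - k - 1) := by
      have : (0 : ℝ) < n - k - 2 := by linarith
      have : (0 : ℝ) < n - k - 1 := by linarith
      positivity
    nlinarith [mul_neg_of_pos_of_neg e2 e1]

/-- The quotient of `quotientCubic s _ (k s + 1) - quotientCubic 1 _ (k + 1)` by `s - 1`. -/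
def cubicDifference (k s n x : ℝ) : ℝ :=
  -(k * x ^ 2) + (6 * k + 3 * k * s + 3 - 2 * n * k + 2 * k ^ 2 * (s + 1)) * x + 2 * k
    - (2 * k * n - 2 * k - 2 - n) - (-(2 * k ^ 2) - k + 1 - k * n) * (s + 1)
    - k * (k + 1) * (s ^ 2 + s + 1)

theorem quotientCubic_sub (k s n x : ℝ) :
    quotientCubic s (n - (k + 1) * s - 1) (k * s + 1) x =
      quotientCubic 1 (n - k - 2) (k + 1) x + (s - 1) * cubicDifference k s n x := by
  simp only [quotientCubic, cubicDifference]
  ring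

/-- After shifting every parameter to its least value, the negated expression expands with no
negative coefficient. -/
theorem cubicDifference_neg_of_three_le {k t m e : ℝ} (hk : 0 ≤ k) (ht : 0 ≤ t) (hm : 0 ≤ m)
    (he : 0 ≤ e) {n : ℝ} (hn : n = (k + 3 + 1) * (t + 2) + 2 + m) :
    cubicDifference (k + 3) (t + 2) n (n + (k + 3) + 5 / 4 + e) < 0 := by
  subst hn
  rw [← neg_pos, cubicDifference]
  ring_nf
  positivity

theorem cubicDifference_neg {k s m n : ℕ} {x : ℝ} (hk : 1 ≤ k) (hs : 2 ≤ s) (hm : 1 ≤ m)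
    (hn : 4 / (k : ℝ) + k + 5 ≤ n) (hsum : s + m + (k * s + 1) = n)
    (hx : (n : ℝ) + k + 5 / 4 ≤ x) : cubicDifference k s n x < 0 := by
  obtain ⟨-, h1, h2, -⟩ := le_of_four_div_add_le hk hn
  obtain ⟨e, rfl⟩ : ∃ e, x = n + k + 5 / 4 + e := ⟨x - (n + k + 5 / 4), by ring⟩
  have he : 0 ≤ e := by linarith
  subst hsum
  obtain ⟨m, rfl⟩ := Nat.exists_eq_add_of_le hm
  obtain ⟨t, rfl⟩ := Nat.exists_eq_add_of_le hs
  obtain rfl | rfl | hk3 : k = 1 ∨ k = 2 ∨ 3 ≤ k := by omega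
  · have h := h1 rfl
    rw [← neg_pos, cubicDifference]
    -- Here `n ≥ 10` reads `2 t + m ≥ 4`; each case shifts variables until all coefficients are
    -- positive.
    obtain h | h | h : 2 ≤ t ∨ 1 ≤ t ∧ 2 ≤ m ∨ 4 ≤ m := by omega
    · obtain ⟨t, rfl⟩ := Nat.exists_eq_add_of_le h
      push_cast
      ring_nf
      positivity
    · obtain ⟨t, rfl⟩ := Nat.exists_eq_add_of_le h.1
      obtain ⟨m, rfl⟩ := Nat.exists_eq_add_of_le h.2
      push_cast
      ring_nf
      positivity
    · obtain ⟨m, rfl⟩ := Nat.exists_eq_add_of_le h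
      push_cast
      ring_nf
      positivity
  · have h := h2 rfl
    rw [← neg_pos, cubicDifference]
    obtain h | h : 1 ≤ t ∨ 1 ≤ m := by omega
    · obtain ⟨t, rfl⟩ := Nat.exists_eq_add_of_le h
      push_cast
      ring_nf
      positivity
    · obtain ⟨m, rfl⟩ := Nat.exists_eq_add_of_le h
      push_cast
      ring_nf
      positivity
  · obtain ⟨k, rfl⟩ := Nat.exists_eq_add_of_le hk3
    have := cubicDifference_neg_of_three_le (k := k) (t := t) (m := m) (e := e)
      (by positivity) (by positivity) (by positivity) he rfl
    push_cast
    convert this using 1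
    simp only [cubicDifference]
    ring

end DistTough

namespace DistTough

open Matrix Finset

/-! ### Bounds on the largest eigenvalue -/

section Rayleigh

variable {V : Type*} [Fintype V] [DecidableEq V]

theorem dotProduct_mulVec_le_iSup_eigenvalues {A : Matrix V V ℝ} (hA : A.IsHermitian)
    (y : V → ℝ) : y ⬝ᵥ A *ᵥ y ≤ (⨆ i, hA.eigenvalues i) * (y ⬝ᵥ y) := by
  set u := hA.eigenvectorBasis
  have key : ∀ z w : V → ℝ,
      ∑ i, (z ⬝ᵥ (u i : V → ℝ)) * ((u i : V → ℝ) ⬝ᵥ w) = z ⬝ᵥ w := by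
    intro z w
    have := u.sum_inner_mul_inner (WithLp.toLp 2 z) (WithLp.toLp 2 w)
    simpa [EuclideanSpace.inner_eq_star_dotProduct, dotProduct_comm] using this
  have hT : Aᵀ = A := by simpa [IsHermitian, conjTranspose_eq_transpose_of_trivial] using hA
  have h1 : ∀ i, (u i : V → ℝ) ⬝ᵥ A *ᵥ y = hA.eigenvalues i * ((u i : V → ℝ) ⬝ᵥ y) := by
    intro i
    rw [dotProduct_mulVec, ← mulVec_transpose, hT, hA.mulVec_eigenvectorBasis i, smul_dotProduct,
      smul_eq_mul]
  rw [← key y (A *ᵥ y), ← key y y, mul_sum]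
  refine sum_le_sum fun i _ => ?_
  rw [h1, dotProduct_comm y]
  have h2 : hA.eigenvalues i ≤ ⨆ i, hA.eigenvalues i :=
    le_ciSup (Set.finite_range _).bddAbove i
  nlinarith [mul_self_nonneg ((u i : V → ℝ) ⬝ᵥ y)]

/-- The half of Perron–Frobenius needed here: a positive eigenvector of a nonnegative symmetric
matrix belongs to its largest eigenvalue. -/
theorem iSup_eigenvalues_le_of_mulVec_eq [Nonempty V] {A : Matrix V V ℝ} (hA : A.IsHermitian)
    (h0 : ∀ u v, 0 ≤ A u v) {y : V → ℝ} (hy : ∀ v, 0 < y v) {x : ℝ} (h : A *ᵥ y = x • y) :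
    ⨆ i, hA.eigenvalues i ≤ x := by
  have hsymm : ∀ u v, A v u = A u v := fun u v => by simpa using hA.apply u v
  refine ciSup_le fun i => ?_
  set z : V → ℝ := (hA.eigenvectorBasis i).ofLp with hz
  have hzA : A *ᵥ z = hA.eigenvalues i • z := hA.mulVec_eigenvectorBasis i
  have hzpos : 0 < ∑ v, z v ^ 2 := by
    refine lt_of_le_of_ne (sum_nonneg fun v _ => sq_nonneg _) fun h => ?_
    have h1 := hA.eigenvectorBasis.orthonormal.1 i
    have h2 : ‖hA.eigenvectorBasis i‖ ^ 2 = ∑ v, z v ^ 2 := by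
      rw [EuclideanSpace.norm_sq_eq]
      simp [hz]
    rw [← h, h1] at h2
    norm_num at h2
  have hrow : ∀ u, ∑ v, A u v * y v = x * y u := fun u => by
    simpa [mulVec, dotProduct] using congrFun h u
  have hrow' : ∀ u, ∑ v, A u v * z v = hA.eigenvalues i * z u := fun u => by
    simpa [mulVec, dotProduct] using congrFun hzA u
  have hS : ∑ u, ∑ v, A u v * (y v / y u * z u ^ 2) = x * ∑ v, z v ^ 2 := by
    rw [mul_sum]
    refine sum_congr rfl fun u _ => ?_
    have : ∑ v, A u v * (y v / y u * z u ^ 2) = (∑ v, A u v * y v) * (z u ^ 2 / y u) := by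
      rw [sum_mul]
      exact sum_congr rfl fun v _ => by ring
    rw [this, hrow]
    field_simp [(hy u).ne']
  have hS' : ∑ u, ∑ v, A u v * (y u / y v * z v ^ 2) = x * ∑ v, z v ^ 2 := by
    rw [← hS, sum_comm]
    exact sum_congr rfl fun u _ => sum_congr rfl fun v _ => by rw [hsymm]
  have hQ : ∑ u, ∑ v, A u v * (2 * (z u * z v)) = 2 * (hA.eigenvalues i * ∑ v, z v ^ 2) := by
    rw [mul_sum, mul_sum]
    refine sum_congr rfl fun u _ => ?_
    have : ∑ v, A u v * (2 * (z u * z v)) = (∑ v, A u v * z v) * (2 * z u) := by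
      rw [sum_mul]
      exact sum_congr rfl fun v _ => by ring
    rw [this, hrow']
    ring
  -- Weighted AM-GM with ratio `y v / y u`, chosen so that both sums on the right collapse by the
  -- eigenvector equation.
  have hle : ∑ u, ∑ v, A u v * (2 * (z u * z v)) ≤
      ∑ u, ∑ v, A u v * (y v / y u * z u ^ 2) + ∑ u, ∑ v, A u v * (y u / y v * z v ^ 2) := by
    rw [← sum_add_distrib]
    refine sum_le_sum fun u _ => ?_
    rw [← sum_add_distrib]
    refine sum_le_sum fun v _ => ?_
    rw [← mul_add]
    refine mul_le_mul_of_nonneg_left ?_ (h0 u v)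
    have hu := hy u
    have hv := hy v
    have e : y v / y u * z u ^ 2 + y u / y v * z v ^ 2 - 2 * (z u * z v) =
        (y v * z u - y u * z v) ^ 2 / (y u * y v) := by
      field_simp
      ring
    have : 0 ≤ (y v * z u - y u * z v) ^ 2 / (y u * y v) := by positivity
    linarith
  rw [hQ, hS, hS'] at hle
  by_contra! hlt
  nlinarith

theorem distLambdaOne_le_of_mulVec_eq [Nonempty V] (G : SimpleGraph V) {y : V → ℝ}
    (hy : ∀ v, 0 < y v) {x : ℝ} (h : distMatrix G *ᵥ y = x • y) : distLambdaOne G ≤ x :=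
  iSup_eigenvalues_le_of_mulVec_eq _ (fun u v => by simp [distMatrix]) hy h

theorem dotProduct_distMatrix_mulVec_le (G : SimpleGraph V) (y : V → ℝ) :
    y ⬝ᵥ distMatrix G *ᵥ y ≤ distLambdaOne G * (y ⬝ᵥ y) :=
  dotProduct_mulVec_le_iSup_eigenvalues _ y

end Rayleigh

/-! ### The model distance matrix -/

section ThreeClass

/-- The distances between distinct vertices in `K_s ∨ (K_m ∪ p K₁)`, in terms of their classes:
`0` is the class of `K_s`, `1` that of `K_m`, `2` that of `p K₁`. -/
def classWeight (i j : Fin 3) : ℝ :=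
  if (i = 2 ∧ j ≠ 0) ∨ (j = 2 ∧ i ≠ 0) then 2 else 1

/-- The distance matrix of `K_s ∨ (K_m ∪ p K₁)`, the classes of the vertices being given by `f`. -/
def threeClassMatrix {V : Type*} [DecidableEq V] (f : V → Fin 3) : Matrix V V ℝ :=
  Matrix.of fun u v => if u = v then 0 else classWeight (f u) (f v)

theorem sum_comp_eq_sum_card_mul {V ι : Type*} [Fintype V] [Fintype ι] [DecidableEq ι] (f : V → ι)
    (F : ι → ℝ) : ∑ v, F (f v) = ∑ j, ((univ.filter fun v => f v = j).card : ℝ) * F j := by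
  rw [← sum_fiberwise univ f]
  refine sum_congr rfl fun j _ => ?_
  rw [sum_congr rfl fun v hv => by rw [(mem_filter.1 hv).2], sum_const, nsmul_eq_mul]

theorem threeClassMatrix_mulVec {V : Type*} [Fintype V] [DecidableEq V] {f : V → Fin 3} {s m p a b c x : ℝ}
    (hs : ((univ.filter fun v => f v = 0).card : ℝ) = s)
    (hm : ((univ.filter fun v => f v = 1).card : ℝ) = m)
    (hp : ((univ.filter fun v => f v = 2).card : ℝ) = p)
    (h0 : (s - 1) * a + m * b + p * c = x * a)
    (h1 : s * a + (m - 1) * b + 2 * p * c = x * b)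
    (h2 : s * a + 2 * m * b + 2 * (p - 1) * c = x * c) :
    threeClassMatrix f *ᵥ (fun v => ![a, b, c] (f v)) = x • fun v => ![a, b, c] (f v) := by
  ext u
  -- The class weight ignores the zero diagonal, so the term `v = u` is subtracted; this produces `s
  -- - 1`, `m - 1` and `p - 1`.
  have e : ∀ v, threeClassMatrix f u v * ![a, b, c] (f v) =
      classWeight (f u) (f v) * ![a, b, c] (f v) -
        if u = v then classWeight (f u) (f u) * ![a, b, c] (f u) else 0 := by
    intro v
    by_cases huv : u = v
    · subst huv
      simp [threeClassMatrix]
    · simp [threeClassMatrix, huv]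
  simp only [mulVec, dotProduct, e, sum_sub_distrib, sum_ite_eq, mem_univ, if_true,
    sum_comp_eq_sum_card_mul f fun j => classWeight (f u) j * ![a, b, c] j, Fin.sum_univ_three,
    hs, hm, hp, Pi.smul_apply, smul_eq_mul]
  generalize f u = i
  fin_cases i
  · simp [classWeight]
    linarith
  · simp [classWeight]
    linarith
  · simp [classWeight]
    linarith

end ThreeClass

end DistTough

namespace DistTough

open Matrix Finset

/-! ### Components as colourings, and toughness -/

section Components

variable {V : Type*} {G : SimpleGraph V} {S : Finset V}

theorem card_le_numComponentsDelete [Finite V] {C : Type*} (φ : V → C)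
    (hφ : ∀ u v, u ∉ S → v ∉ S → G.Adj u v → φ u = φ v) (hsurj : ∀ c, ∃ v, v ∉ S ∧ φ v = c) :
    Nat.card C ≤ numComponentsDelete G S := by
  have hadj : ∀ u v : ((S : Set V)ᶜ : Set V), (G.induce ((S : Set V)ᶜ)).Reachable u v →
      φ u = φ v := by
    rintro u v ⟨w⟩
    induction w with
    | nil => rfl
    | @cons x y _ h _ ih =>
      exact (hφ x y x.2 y.2 h).trans ih
  refine Nat.card_le_card_of_surjective
    (SimpleGraph.ConnectedComponent.lift (fun v => φ v) fun u v w _ => hadj u v ⟨w⟩) fun c => ?_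
  obtain ⟨v, hv, rfl⟩ := hsurj c
  exact ⟨SimpleGraph.connectedComponentMk _ ⟨v, by simpa using hv⟩, rfl⟩

theorem exists_coloring_of_le_numComponentsDelete [Finite V] {q : ℕ}
    (h : q + 1 ≤ numComponentsDelete G S) :
    ∃ φ : V → Fin (q + 1), (∀ u v, u ∉ S → v ∉ S → G.Adj u v → φ u = φ v) ∧
      ∀ c, ∃ v, v ∉ S ∧ φ v = c := by
  classical
  set H := G.induce ((S : Set V)ᶜ)
  have := Fintype.ofFinite H.ConnectedComponent
  have hc : Fintype.card (Fin (q + 1)) ≤ Fintype.card H.ConnectedComponent := by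
    rw [Fintype.card_fin, ← Nat.card_eq_fintype_card]
    exact h
  obtain ⟨g⟩ := Function.Embedding.nonempty_of_card_le hc
  have hg : Function.Surjective (Function.invFun g) := Function.invFun_surjective g.injective
  -- The left inverse of an embedding of the colours merges surplus components; the colour `0` on
  -- `S` is a dummy value.
  refine ⟨fun v => if hv : v ∈ S then 0 else
    Function.invFun g (H.connectedComponentMk ⟨v, by simpa using hv⟩), ?_, ?_⟩
  · intro u v hu hv huv
    simp only [hu, hv, dite_false]
    congr 1
    rw [SimpleGraph.ConnectedComponent.eq]
    exact SimpleGraph.Adj.reachable (by simpa [H] using huv)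
  · intro c
    obtain ⟨d, rfl⟩ := hg c
    obtain ⟨⟨v, hv⟩, rfl⟩ := d.exists_rep
    have hv' : v ∉ S := by simpa using hv
    exact ⟨v, hv', by simp only [hv', dite_false]; rfl⟩

theorem exists_of_not_isTough {k : ℕ} {τ : ℝ} (hk : 1 ≤ k) (hτ : 1 / τ = k)
    (h : ¬ IsTough G τ) : ∃ S : Finset V, k * S.card + 2 ≤ numComponentsDelete G S := by
  rw [IsTough, not_le, toughnessVariation, iInf_lt_iff] at h
  obtain ⟨S, h⟩ := h
  rw [iInf_lt_iff] at h
  obtain ⟨hc, h⟩ := h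
  refine ⟨S, ?_⟩
  rw [EReal.coe_lt_coe_iff] at h
  have hk0 : (0 : ℝ) < k := by exact_mod_cast hk
  have hτk : τ = 1 / k := by rw [← hτ, one_div_one_div]
  have hc' : (0 : ℝ) < (numComponentsDelete G S : ℝ) - 1 := by
    have : (1 : ℝ) < numComponentsDelete G S := by exact_mod_cast hc
    linarith
  rw [hτk, div_lt_div_iff₀ hc' hk0] at h
  have : ((k * S.card + 1 : ℕ) : ℝ) < numComponentsDelete G S := by push_cast; linarith
  have : k * S.card + 1 < numComponentsDelete G S := by exact_mod_cast this
  omega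

theorem not_isTough_of_le_numComponentsDelete {k : ℕ} {τ : ℝ} (hk : 1 ≤ k) (hτ : 1 / τ = k)
    (h : k * S.card + 2 ≤ numComponentsDelete G S) : ¬ IsTough G τ := by
  rw [IsTough, not_le, toughnessVariation, iInf_lt_iff]
  refine ⟨S, ?_⟩
  rw [iInf_lt_iff]
  refine ⟨by omega, ?_⟩
  rw [EReal.coe_lt_coe_iff]
  have hk0 : (0 : ℝ) < k := by exact_mod_cast hk
  have hτk : τ = 1 / k := by rw [← hτ, one_div_one_div]
  have h' : (k : ℝ) * S.card + 2 ≤ numComponentsDelete G S := by exact_mod_cast h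
  have : (0 : ℝ) ≤ (k : ℝ) * S.card := by positivity
  rw [hτk, div_lt_div_iff₀ (by linarith) hk0]
  linarith

theorem nonempty_of_coloring (hG : G.Connected) {C : Type*} [Nontrivial C] {φ : V → C}
    (hφ : ∀ u v, u ∉ S → v ∉ S → G.Adj u v → φ u = φ v) (hsurj : ∀ c, ∃ v, v ∉ S ∧ φ v = c) :
    S.Nonempty := by
  by_contra hS
  rw [not_nonempty_iff_eq_empty] at hS
  subst hS
  have hconst : ∀ u v, φ u = φ v := by
    intro u v
    obtain ⟨w⟩ := hG.preconnected u v
    induction w with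
    | nil => rfl
    | cons h _ ih => exact (hφ _ _ (by simp) (by simp) h).trans ih
  obtain ⟨c, d, hcd⟩ := exists_pair_ne C
  obtain ⟨u, -, rfl⟩ := hsurj c
  obtain ⟨v, -, rfl⟩ := hsurj d
  exact hcd (hconst u v)

end Components

/-! ### Recovering a graph from its three classes -/

section ThreeClassGraph

theorem classWeight_eq_one_or (i j : Fin 3) : classWeight i j = 1 ∨ classWeight i j = 2 := by
  unfold classWeight
  split_ifs <;> simp

theorem classWeight_zero_left (j : Fin 3) : classWeight 0 j = 1 := by
  simp [classWeight]

theorem classWeight_zero_right (i : Fin 3) : classWeight i 0 = 1 := by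
  simp [classWeight]

variable {V : Type*} [DecidableEq V] {G : SimpleGraph V} {f : V → Fin 3}

/-- The vertex `z` is adjacent to all others, so distinct nonadjacent vertices are at distance
exactly two. -/
theorem distMatrix_eq_threeClassMatrix
    (h : ∀ u v, G.Adj u v ↔ u ≠ v ∧ classWeight (f u) (f v) = 1) {z : V} (hz : f z = 0) :
    distMatrix G = threeClassMatrix f := by
  have hzadj : ∀ u, u ≠ z → G.Adj u z := fun u hu => by simp [h, hu, hz, classWeight_zero_right]
  have hzreach : ∀ u, G.Reachable u z := fun u => by
    by_cases hu : u = z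
    · rw [hu]
    · exact (hzadj u hu).reachable
  ext u v
  simp only [distMatrix, threeClassMatrix, of_apply]
  by_cases huv : u = v
  · simp [huv]
  rw [if_neg huv]
  by_cases hadj : G.Adj u v
  · rw [SimpleGraph.dist_eq_one_iff_adj.2 hadj, ((h u v).1 hadj).2, Nat.cast_one]
  · have h2 : classWeight (f u) (f v) = 2 :=
      (classWeight_eq_one_or _ _).resolve_left fun h1 => hadj ((h u v).2 ⟨huv, h1⟩)
    have huz : u ≠ z := by
      rintro rfl
      rw [hz, classWeight_zero_left] at h2
      norm_num at h2
    have hvz : v ≠ z := by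
      rintro rfl
      rw [hz, classWeight_zero_right] at h2
      norm_num at h2
    have hlt := ((hzreach u).trans (hzreach v).symm).one_lt_dist_of_ne_of_not_adj huv hadj
    have hle := SimpleGraph.dist_le
      (SimpleGraph.Walk.cons (hzadj u huz) (hzadj v hvz).symm.toWalk)
    simp only [SimpleGraph.Walk.length_cons, SimpleGraph.Walk.length_nil,
      SimpleGraph.Adj.toWalk] at hle
    rw [h2, show G.dist u v = 2 by omega, Nat.cast_ofNat]

theorem adj_iff_of_distMatrix_eq (h : distMatrix G = threeClassMatrix f) (u v : V) :
    G.Adj u v ↔ u ≠ v ∧ classWeight (f u) (f v) = 1 := by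
  have huv : (G.dist u v : ℝ) = if u = v then 0 else classWeight (f u) (f v) :=
    congrFun (congrFun h u) v
  rw [← SimpleGraph.dist_eq_one_iff_adj, ← Nat.cast_eq_one (R := ℝ), huv]
  split_ifs with h <;> simp [h]

end ThreeClassGraph

/-! ### The extremal graph -/

section Extremal

variable {n k : ℕ}

/-- The three classes of vertices of `extremalGraph n k`. -/
def extremalClass (n k : ℕ) : Fin 1 ⊕ (Fin (n - k - 2) ⊕ Fin (k + 1)) → Fin 3 :=
  Sum.elim (fun _ => 0) (Sum.elim (fun _ => 1) fun _ => 2)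

theorem extremalGraph_adj_iff (u v : Fin 1 ⊕ (Fin (n - k - 2) ⊕ Fin (k + 1))) :
    (extremalGraph n k).Adj u v ↔
      u ≠ v ∧ classWeight (extremalClass n k u) (extremalClass n k v) = 1 := by
  rcases u with u | u | u <;> rcases v with v | v | v <;>
    simp [extremalGraph, join, extremalClass, classWeight, eq_iff_true_of_subsingleton]

theorem distMatrix_extremalGraph :
    distMatrix (extremalGraph n k) = threeClassMatrix (extremalClass n k) :=
  distMatrix_eq_threeClassMatrix extremalGraph_adj_iff (z := Sum.inl 0) rfl

theorem card_extremalClass_zero :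
    (univ.filter fun v => extremalClass n k v = 0).card = 1 := by
  rw [card_filter]
  simp [extremalClass]

theorem card_extremalClass_one :
    (univ.filter fun v => extremalClass n k v = 1).card = n - k - 2 := by
  rw [card_filter]
  simp [extremalClass]

theorem card_extremalClass_two :
    (univ.filter fun v => extremalClass n k v = 2).card = k + 1 := by
  rw [card_filter]
  simp [extremalClass]

theorem not_isTough_of_iso {V : Type*} [Fintype V] {G : SimpleGraph V} {τ : ℝ} (hk : 1 ≤ k)
    (hτ : 1 / τ = k) (hn : k + 3 ≤ n) (e : G ≃g extremalGraph n k) : ¬ IsTough G τ := by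
  set z : V := e.symm (Sum.inl 0) with hz
  have hez : ∀ v, v ≠ z → ∀ i, e v ≠ Sum.inl i := by
    intro v hv i h
    apply hv
    rw [hz, Subsingleton.elim 0 i, ← h]
    simp
  refine not_isTough_of_le_numComponentsDelete (S := {z}) hk hτ ?_
  -- One colour for the clique and one per isolated vertex, `k + 2` in all; the value at the deleted
  -- centre is irrelevant.
  let ψ : Fin 1 ⊕ (Fin (n - k - 2) ⊕ Fin (k + 1)) → Option (Fin (k + 1)) :=
    Sum.elim (fun _ => none) (Sum.elim (fun _ => none) some)
  have := card_le_numComponentsDelete (G := G) (S := {z}) (fun v => ψ (e v)) ?_ ?_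
  · rw [Nat.card_eq_fintype_card, Fintype.card_option, Fintype.card_fin] at this
    rw [card_singleton]
    omega
  · intro u v hu hv huv
    rw [mem_singleton] at hu hv
    have hu' := hez u hu
    have hv' := hez v hv
    rw [← e.map_adj_iff, extremalGraph_adj_iff] at huv
    revert hu' hv' huv
    generalize e u = u'
    generalize e v = v'
    rcases u' with u' | u' | u' <;> rcases v' with v' | v' | v' <;>
      simp [ψ, extremalClass, classWeight]
  · intro c
    have hne : ∀ w, e.symm (Sum.inr w) ≠ z := fun w h => by
      rw [hz] at h
      simpa using e.symm.injective h
    rcases c with _ | c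
    · exact ⟨e.symm (Sum.inr (Sum.inl ⟨0, by omega⟩)), by simpa using hne _, by simp [ψ]⟩
    · exact ⟨e.symm (Sum.inr (Sum.inr c)), by simpa using hne _, by simp [ψ]⟩

theorem nonempty_iso_extremalGraph {V : Type*} [Fintype V] {G : SimpleGraph V} {f : V → Fin 3}
    (h : ∀ u v, G.Adj u v ↔ u ≠ v ∧ classWeight (f u) (f v) = 1)
    (h0 : (univ.filter fun v => f v = 0).card = 1)
    (h1 : (univ.filter fun v => f v = 1).card = n - k - 2)
    (h2 : (univ.filter fun v => f v = 2).card = k + 1) :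
    Nonempty (G ≃g extremalGraph n k) := by
  have hcard : ∀ c, Fintype.card {v // f v = c} = Fintype.card {w // extremalClass n k w = c} := by
    intro c
    rw [Fintype.card_subtype, Fintype.card_subtype]
    fin_cases c
    · exact h0.trans card_extremalClass_zero.symm
    · exact h1.trans card_extremalClass_one.symm
    · exact h2.trans card_extremalClass_two.symm
  let e := Equiv.ofFiberEquiv fun c => Fintype.equivOfCardEq (hcard c)
  have he : ∀ v, extremalClass n k (e v) = f v := Equiv.ofFiberEquiv_map _
  exact ⟨⟨e, by intro u v; rw [extremalGraph_adj_iff, h, he, he, e.injective.ne_iff]⟩⟩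

end Extremal

end DistTough

namespace DistTough

/-! ### Comparison of the distance forms -/

open Matrix Finset

variable {V : Type*} [Fintype V] [DecidableEq V] {G : SimpleGraph V}

/-- Moving vertices of the colour classes outside `S` other than a largest one `q₀` into `q₀`,
while keeping a representative in each of them, turns `G` into a subgraph of
`K_s ∨ (K_m ∪ p K₁)`; this does not increase the distance quadratic form at the vectors of
interest. -/
theorem exists_threeClass_of_coloring (hG : G.Connected) {S : Finset V} {p : ℕ}
    {φ : V → Fin (p + 1)} (hφ : ∀ u v, u ∉ S → v ∉ S → G.Adj u v → φ u = φ v)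
    (hsurj : ∀ c, ∃ v, v ∉ S ∧ φ v = c) :
    ∃ f : V → Fin 3, (univ.filter fun v => f v = 0).card = S.card ∧
      1 ≤ (univ.filter fun v => f v = 1).card ∧ (univ.filter fun v => f v = 2).card = p ∧
      ∀ a b c : ℝ, 0 < a → 0 < b → 0 < c → c < 2 * b →
        (fun v => ![a, b, c] (f v)) ⬝ᵥ threeClassMatrix f *ᵥ (fun v => ![a, b, c] (f v)) <
          (fun v => ![a, b, c] (f v)) ⬝ᵥ distMatrix G *ᵥ (fun v => ![a, b, c] (f v)) ∨
        distMatrix G = threeClassMatrix f := by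
  choose r hrS hrφ using hsurj
  obtain ⟨q, -, hq⟩ := exists_max_image univ
    (fun i => (univ.filter fun v => v ∉ S ∧ φ v = i).card) univ_nonempty
  set f : V → Fin 3 := fun v => if v ∈ S then 0 else if r (φ v) = v ∧ φ v ≠ q then 2 else 1 with hf
  have hf0 : ∀ v, f v = 0 ↔ v ∈ S := by
    intro v
    simp only [hf]
    split_ifs <;> simp_all
  have hf2 : ∀ v, f v = 2 ↔ v ∉ S ∧ r (φ v) = v ∧ φ v ≠ q := by
    intro v
    simp only [hf]
    split_ifs with h h'
    · simp [h]
    · simp [h, h'.1, h'.2]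
    · simp only [h, h', not_false_eq_true, and_false, iff_false]
      decide
  have hf1 : ∀ v, f v = 1 ↔ v ∉ S ∧ ¬ (r (φ v) = v ∧ φ v ≠ q) := by
    intro v
    simp only [hf]
    split_ifs with h h'
    · simp [h]
    · simp [h, h'.1, h'.2]
    · simp only [h, h', not_false_eq_true, and_self]
  have hrinj : Function.Injective r := fun i j h => by rw [← hrφ i, h, hrφ]
  have hr2 : ∀ i, i ≠ q → f (r i) = 2 := fun i hi =>
    (hf2 _).2 ⟨hrS i, by rw [hrφ], by rwa [hrφ]⟩
  have hq1 : f (r q) = 1 := (hf1 _).2 ⟨hrS q, by simp [hrφ]⟩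
  refine ⟨f, ?_, ?_, ?_, ?_⟩
  · congr 1
    ext v
    simp [hf0]
  · exact card_pos.2 ⟨r q, by simp [hq1]⟩
  · have : (univ.filter fun v => f v = 2) = (univ.erase q).image r := by
      ext v
      simp only [mem_filter, mem_univ, true_and, mem_image, mem_erase, and_true]
      constructor
      · intro h
        exact ⟨φ v, ((hf2 v).1 h).2.2, ((hf2 v).1 h).2.1⟩
      · rintro ⟨i, hi, rfl⟩
        exact hr2 i hi
    rw [this, card_image_of_injective _ hrinj, card_erase_of_mem (mem_univ _), card_univ,
      Fintype.card_fin, Nat.add_sub_cancel]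
  intro a b c ha hb hc hcb
  set y : V → ℝ := fun v => ![a, b, c] (f v) with hy
  have hy1 : ∀ v, f v = 1 → y v = b := fun v h => by simp [hy, h]
  have hy2 : ∀ v, f v = 2 → y v = c := fun v h => by simp [hy, h]
  have hypos : ∀ v, 0 < y v := by
    intro v
    simp only [hy]
    generalize f v = i
    fin_cases i <;> simpa
  set P : V → Prop := fun u => u ∉ S ∧ φ u ≠ q ∧ r (φ u) ≠ u with hP
  -- A class containing a moved vertex also contains its representative, so the largest class has at
  -- least two vertices.
  obtain ⟨w, w', hw⟩ : ∃ w w', ∀ u, P u → w ∉ S ∧ φ w = q ∧ w' ∉ S ∧ φ w' = q ∧ w ≠ w' := by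
    by_cases h : ∃ u, P u
    · obtain ⟨u, huS, huq, hur⟩ := h
      have h1 : 1 < (univ.filter fun v => v ∉ S ∧ φ v = φ u).card :=
        one_lt_card.2 ⟨u, by simp [huS], r (φ u), by simp [hrS, hrφ], hur.symm⟩
      obtain ⟨w, hw, w', hw', hww⟩ := one_lt_card.1 (h1.trans_le (hq (φ u) (mem_univ _)))
      simp only [mem_filter, mem_univ, true_and] at hw hw'
      exact ⟨w, w', fun _ _ => ⟨hw.1, hw.2, hw'.1, hw'.2, hww⟩⟩
    · exact ⟨r q, r q, fun u hu => (h ⟨u, hu⟩).elim⟩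
  classical
  -- Accounting for moving `u`: it comes closer to `w` and `w'` by at least one each, and may recede
  -- by one from its old representative. The net gain `y u * (2 * b - c)` is positive.
  set E : V → V → ℝ := fun u v => if P u then
    (if v = w then 1 else 0) + (if v = w' then 1 else 0) - (if v = r (φ u) then 1 else 0)
    else 0 with hE
  have hEnot : ∀ u v, ¬ P u → E u v = 0 := fun u v h => by simp [hE, h]
  have hEsum : ∀ u, ∑ v, E u v * y v = if P u then 2 * b - c else 0 := by
    intro u
    by_cases hu : P u
    · obtain ⟨hwS, hwq, hwS', hwq', -⟩ := hw u hu
      have e1 : y w = b := hy1 _ ((hf1 _).2 ⟨hwS, by simp [hwq]⟩)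
      have e2 : y w' = b := hy1 _ ((hf1 _).2 ⟨hwS', by simp [hwq']⟩)
      have e3 : y (r (φ u)) = c := hy2 _ (hr2 _ hu.2.1)
      simp only [hE, hu, if_true, sub_mul, add_mul, ite_mul, one_mul, zero_mul, sum_sub_distrib,
        sum_add_distrib, sum_ite_eq', mem_univ, e1, e2, e3]
      ring
    · simp [hEnot u _ hu, hu]
  have hD1 : ∀ u v, u ≠ v → 1 ≤ distMatrix G u v := fun u v h => by
    simpa [distMatrix] using Nat.succ_le_of_lt (hG.pos_dist_of_ne h)
  have hD2 : ∀ u v, u ∉ S → v ∉ S → φ u ≠ φ v → 2 ≤ distMatrix G u v := fun u v hu hv h => by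
    have := hG.one_lt_dist_of_ne_of_not_adj (fun e => h (by rw [e])) fun e => h (hφ u v hu hv e)
    simpa [distMatrix] using (Nat.cast_le (α := ℝ)).2 this
  have hEsame : ∀ u v, φ u = φ v → E u v = if P u ∧ v = r (φ u) then -1 else 0 := by
    intro u v h
    by_cases hu : P u
    · obtain ⟨-, hwq, -, hwq', -⟩ := hw u hu
      have e1 : v ≠ w := fun e => hu.2.1 (by rw [h, e, hwq])
      have e2 : v ≠ w' := fun e => hu.2.1 (by rw [h, e, hwq'])
      by_cases hv : v = r (φ u)
      · rw [if_pos ⟨hu, hv⟩]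
        simp only [hE]
        rw [if_pos hu, if_neg e1, if_neg e2, if_pos hv]
        norm_num
      · simp [hE, hu, e1, e2, hv]
    · simp [hE, hu]
  have hEdiff : ∀ u v, φ u ≠ φ v → E u v = 0 ∨ E u v = 1 ∧ P u ∧ v ∉ S ∧ φ v = q := by
    intro u v h
    by_cases hu : P u
    · obtain ⟨hwS, hwq, hwS', hwq', hww⟩ := hw u hu
      have e3 : v ≠ r (φ u) := fun e => h (by rw [e, hrφ])
      by_cases e1 : v = w
      · right
        refine ⟨?_, hu, e1 ▸ hwS, e1 ▸ hwq⟩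
        have : v ≠ w' := e1 ▸ hww
        simp [hE, hu, e1, hww, e1 ▸ e3]
      · by_cases e2 : v = w'
        · right
          refine ⟨?_, hu, e2 ▸ hwS', e2 ▸ hwq'⟩
          simp [hE, hu, e2, hww.symm, e2 ▸ e3]
        · left
          simp [hE, hu, e1, e2, e3]
    · exact Or.inl (hEnot u v hu)
  have hPf : ∀ u, P u → f u = 1 := fun u hu => (hf1 u).2 ⟨hu.1, fun h => hu.2.2 h.1⟩
  have hES : ∀ u v, u ∈ S → E u v = 0 ∧ E v u = 0 := by
    intro u v hu
    refine ⟨hEnot u v fun h => h.1 hu, ?_⟩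
    by_cases hv : P v
    · obtain ⟨hwS, -, hwS', -, -⟩ := hw v hv
      have e1 : u ≠ w := fun e => hwS (e ▸ hu)
      have e2 : u ≠ w' := fun e => hwS' (e ▸ hu)
      have e3 : u ≠ r (φ v) := fun e => hrS _ (e ▸ hu)
      simp [hE, e1, e2, e3]
    · exact hEnot v u hv
  have hentry : ∀ u v, threeClassMatrix f u v + E u v + E v u ≤ distMatrix G u v := by
    intro u v
    by_cases huv : u = v
    · subst huv
      have : E u u = 0 := by
        rw [hEsame u u rfl, if_neg]
        rintro ⟨h1, h2⟩
        exact h1.2.2 h2.symm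
      simp [threeClassMatrix, this, distMatrix]
    have hT : threeClassMatrix f u v = classWeight (f u) (f v) := by simp [threeClassMatrix, huv]
    rw [hT]
    by_cases hu : u ∈ S
    · rw [(hES u v hu).1, (hES u v hu).2, (hf0 u).2 hu, classWeight_zero_left]
      linarith [hD1 u v huv]
    by_cases hv : v ∈ S
    · rw [(hES v u hv).1, (hES v u hv).2, (hf0 v).2 hv, classWeight_zero_right]
      linarith [hD1 u v huv]
    by_cases hc : φ u = φ v
    · have hD := hD1 u v huv
      have h1 : ∀ u v, φ u = φ v → E u v ≤ 0 := by
        intro u v h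
        rw [hEsame u v h]
        split_ifs <;> norm_num
      have h2 : ∀ u v, u ≠ v → u ∉ S → φ u = φ v → f v = 2 → E u v = -1 := by
        intro u v huv hu h hv
        obtain ⟨-, h3, h4⟩ := (hf2 v).1 hv
        have : P u := ⟨hu, by rwa [h], by rw [h, h3]; exact huv.symm⟩
        rw [hEsame u v h, if_pos ⟨this, by rw [h, h3]⟩]
      have i1 := h1 u v hc
      have i2 := h1 v u hc.symm
      by_cases h3 : f u = 2
      · have := h2 v u (Ne.symm huv) hv hc.symm h3
        rcases classWeight_eq_one_or (f u) (f v) with h | h <;> linarith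
      by_cases h4 : f v = 2
      · have := h2 u v huv hu hc h4
        rcases classWeight_eq_one_or (f u) (f v) with h | h <;> linarith
      · have : classWeight (f u) (f v) = 1 := by simp [classWeight, h3, h4]
        linarith
    · have hD := hD2 u v hu hv hc
      have h2 : ∀ u v, P u → v ∉ S → φ v = q → classWeight (f u) (f v) = 1 ∧
          classWeight (f v) (f u) = 1 ∧ E v u = 0 := by
        intro u v hu hvS hvq
        have : f v = 1 := (hf1 v).2 ⟨hvS, by simp [hvq]⟩
        rw [hPf u hu, this]
        exact ⟨by simp [classWeight], by simp [classWeight], hEnot v u fun h => h.2.1 hvq⟩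
      rcases hEdiff u v hc with h | ⟨h, hPu, hvS, hvq⟩
      · rcases hEdiff v u (Ne.symm hc) with h' | ⟨h', hPv, huS, huq⟩
        · rcases classWeight_eq_one_or (f u) (f v) with h3 | h3 <;> linarith
        · linarith [(h2 v u hPv huS huq).2.1]
      · obtain ⟨h3, -, h4⟩ := h2 u v hPu hvS hvq
        linarith
  have hquad : ∀ M : Matrix V V ℝ, y ⬝ᵥ M *ᵥ y = ∑ u, ∑ v, y u * (M u v * y v) := by
    intro M
    simp only [dotProduct, mulVec, mul_sum]
  rw [hquad, hquad]
  by_cases hex : ∃ u, P u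
  · left
    obtain ⟨u₀, hu₀⟩ := hex
    have h1 : ∑ u, ∑ v, y u * ((threeClassMatrix f u v + E u v + E v u) * y v) ≤
        ∑ u, ∑ v, y u * (distMatrix G u v * y v) := by
      refine sum_le_sum fun u _ => sum_le_sum fun v _ => ?_
      exact mul_le_mul_of_nonneg_left
        (mul_le_mul_of_nonneg_right (hentry u v) (hypos v).le) (hypos u).le
    have h2 : ∑ u, ∑ v, y u * ((threeClassMatrix f u v + E u v + E v u) * y v) =
        ∑ u, ∑ v, y u * (threeClassMatrix f u v * y v) + ∑ u, ∑ v, y u * (E u v * y v) +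
          ∑ u, ∑ v, y u * (E v u * y v) := by
      simp only [← sum_add_distrib]
      exact sum_congr rfl fun u _ => sum_congr rfl fun v _ => by ring
    have h3 : ∑ u, ∑ v, y u * (E v u * y v) = ∑ u, ∑ v, y u * (E u v * y v) := by
      rw [sum_comm]
      exact sum_congr rfl fun u _ => sum_congr rfl fun v _ => by ring
    have h4 : 0 < ∑ u, ∑ v, y u * (E u v * y v) := by
      simp only [← mul_sum, hEsum]
      refine sum_pos' (fun u _ => mul_nonneg (hypos u).le ?_) ⟨u₀, mem_univ _, ?_⟩
      · split_ifs
        · linarith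
        · rfl
      · rw [if_pos hu₀]
        exact mul_pos (hypos _) (by linarith)
    linarith
  -- Nothing is moved, so the model matrix is entrywise at most the distance matrix; one strict
  -- entry suffices since the vector is positive.
  · push Not at hex
    have hle : ∀ u v, threeClassMatrix f u v ≤ distMatrix G u v := fun u v => by
      have := hentry u v
      rwa [hEnot u v (hex u), hEnot v u (hex v), add_zero, add_zero] at this
    have hle' : ∀ u v, y u * (threeClassMatrix f u v * y v) ≤ y u * (distMatrix G u v * y v) :=
      fun u v => mul_le_mul_of_nonneg_left
        (mul_le_mul_of_nonneg_right (hle u v) (hypos v).le) (hypos u).le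
    by_cases heq : distMatrix G = threeClassMatrix f
    · exact Or.inr heq
    · left
      obtain ⟨u, v, huv⟩ : ∃ u v, distMatrix G u v ≠ threeClassMatrix f u v := by
        by_contra! h
        exact heq (Matrix.ext h)
      have hlt : threeClassMatrix f u v < distMatrix G u v := lt_of_le_of_ne (hle u v) huv.symm
      refine sum_lt_sum (fun u _ => sum_le_sum fun v _ => hle' u v) ⟨u, mem_univ _, ?_⟩
      refine sum_lt_sum (fun v _ => hle' u v) ⟨v, mem_univ _, ?_⟩
      exact mul_lt_mul_of_pos_left (mul_lt_mul_of_pos_right hlt (hypos v)) (hypos u)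

end DistTough

namespace DistTough

/-! ### Conclusion -/

open Matrix Finset

theorem dotProduct_self_pos {V : Type*} [Fintype V] [Nonempty V] {y : V → ℝ}
    (hy : ∀ v, 0 < y v) : 0 < y ⬝ᵥ y :=
  sum_pos (fun v _ => mul_pos (hy v) (hy v)) univ_nonempty

theorem vec_three_pos {a b c : ℝ} (ha : 0 < a) (hb : 0 < b) (hc : 0 < c) (i : Fin 3) :
    0 < ![a, b, c] i := by
  fin_cases i <;> simpa

theorem isTough_of_distLambdaOne_le {V : Type*} [Fintype V] [DecidableEq V] {G : SimpleGraph V}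
    {τ : ℝ} {k n : ℕ} (hk : 1 ≤ k) (hτ : 1 / τ = (k : ℝ)) (hG : G.Connected)
    (hcard : Fintype.card V = n) (hn : 4 / (k : ℝ) + k + 5 ≤ n)
    (hlam : distLambdaOne G ≤ distLambdaOne (extremalGraph n k))
    (hiso : ¬ Nonempty (G ≃g extremalGraph n k)) : IsTough G τ := by
  by_contra htough
  have hkn := (le_of_four_div_add_le hk hn).1
  have hknR : (k : ℝ) + 6 ≤ n := by exact_mod_cast hkn
  have hk0 : (1 : ℝ) ≤ k := by exact_mod_cast hk
  have : Nonempty V := hG.nonempty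
  obtain ⟨x, hx, hroot⟩ := exists_root_gt_of_quotientCubic_neg (quotientCubic_one_neg hk hn)
  obtain ⟨a, b, c, ha, hb, hc, hcb, e0, e1, e2⟩ :=
    exists_pos_eigenvector_of_quotientCubic_eq_zero (by linarith) (by linarith) (by linarith)
      (by linarith) (by linarith) hroot
  have hlamx : distLambdaOne G ≤ x := by
    refine hlam.trans (distLambdaOne_le_of_mulVec_eq _
      (y := fun v => ![a, b, c] (extremalClass n k v)) (fun v => vec_three_pos ha hb hc _) ?_)
    rw [distMatrix_extremalGraph]
    refine threeClassMatrix_mulVec (by rw [card_extremalClass_zero, Nat.cast_one])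
      (by rw [card_extremalClass_one, Nat.sub_sub, Nat.cast_sub (by omega)]; push_cast; ring)
      (by rw [card_extremalClass_two]; push_cast; rfl) e0 e1 e2
  obtain ⟨S, hS⟩ := exists_of_not_isTough hk hτ htough
  obtain ⟨φ, hφ, hsurj⟩ := exists_coloring_of_le_numComponentsDelete (q := k * S.card + 1) hS
  have hSpos : 1 ≤ S.card := card_pos.2 (nonempty_of_coloring hG hφ hsurj)
  obtain ⟨f, f0, f1, f2, hf⟩ := exists_threeClass_of_coloring hG hφ hsurj
  set s := S.card
  set m := (univ.filter fun v => f v = 1).card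
  have hsum : s + m + (k * s + 1) = n := by
    have := card_eq_sum_card_fiberwise (s := (univ : Finset V)) (t := univ) (f := f)
      (fun v _ => mem_univ _)
    rw [Fin.sum_univ_three, f0, f2, card_univ, hcard] at this
    exact this.symm
  have hsumR : (s : ℝ) + m + (k * s + 1) = n := by exact_mod_cast hsum
  have hs1 : (1 : ℝ) ≤ s := by exact_mod_cast hSpos
  have hm1 : (1 : ℝ) ≤ m := by exact_mod_cast f1
  have hks : (k : ℝ) ≤ k * s := by nlinarith
  have hm : (m : ℝ) = n - (k + 1) * s - 1 := by linarith
  -- For `s = 1` the two cubics coincide, so `z = x`, and strictness must come from the distance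
  -- comparison instead.
  obtain ⟨z, hxz, hz, hstrict⟩ : ∃ z, x ≤ z ∧ quotientCubic s m (k * s + 1) z = 0 ∧
      (s = 1 ∨ x < z) := by
    rcases Nat.lt_or_ge s 2 with hs | hs
    · have hs : s = 1 := by omega
      refine ⟨x, le_rfl, ?_, Or.inl hs⟩
      rw [hm, hs, Nat.cast_one]
      convert hroot using 2 <;> ring
    · have hneg : quotientCubic s m (k * s + 1) x < 0 := by
        rw [hm, quotientCubic_sub, hroot, zero_add]
        have hs2 : (2 : ℝ) ≤ s := by exact_mod_cast hs
        exact mul_neg_of_pos_of_neg (by linarith) (cubicDifference_neg hk hs f1 hn hsum hx.le)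
      obtain ⟨z, hz, hz0⟩ := exists_root_gt_of_quotientCubic_neg hneg
      exact ⟨z, hz.le, hz0, Or.inr hz⟩
  obtain ⟨a, b, c, ha, hb, hc, hcb, e0, e1, e2⟩ :=
    exists_pos_eigenvector_of_quotientCubic_eq_zero (by linarith) (by linarith) (by linarith)
      (by linarith) (by linarith) hz
  have hT := threeClassMatrix_mulVec (f := f) (congrArg Nat.cast f0) rfl
    (by rw [f2]; push_cast; rfl) e0 e1 e2
  have hQ := hf a b c ha hb hc hcb
  have hle := dotProduct_distMatrix_mulVec_le G fun v => ![a, b, c] (f v)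
  have hypos := dotProduct_self_pos fun v => vec_three_pos ha hb hc (f v)
  rw [hT, dotProduct_smul, smul_eq_mul] at hQ
  have hlamz := mul_le_mul_of_nonneg_right (hlamx.trans hxz) hypos.le
  rcases hQ with hlt | heq
  -- The form at this vector would exceed `z * (y ⬝ᵥ y)`, whereas `distLambdaOne G ≤ x ≤ z`.
  · linarith
  · rcases hstrict with hs | hxz
    · refine hiso (nonempty_iso_extremalGraph (adj_iff_of_distMatrix_eq heq) (f0.trans hs) ?_ ?_)
      · rw [hs] at hsum
        change m = _
        omega
      · rw [f2, hs, mul_one]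
    · rw [heq, hT, dotProduct_smul, smul_eq_mul] at hle
      have := mul_lt_mul_of_pos_right (hlamx.trans_lt hxz) hypos
      linarith

end DistTough

theorem theorem3 {V : Type*} [Fintype V] [DecidableEq V] (G : SimpleGraph V) (τ : ℝ) (k n : ℕ)
    (hk : 1 ≤ k) (hτ : 1 / τ = (k : ℝ)) (hG : G.Connected) (hcard : Fintype.card V = n)
    (hn : 4 * τ + 1 / τ + 5 ≤ (n : ℝ))
    (hlam : DistTough.distLambdaOne G ≤ DistTough.distLambdaOne (DistTough.extremalGraph n k)) :
    DistTough.IsTough G τ ↔ ¬ Nonempty (G ≃g DistTough.extremalGraph n k) := by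
  have hn' : 4 / (k : ℝ) + k + 5 ≤ n := by
    rw [← hτ, div_div_eq_mul_div, div_one]
    exact hn
  have hkn := (DistTough.le_of_four_div_add_le hk hn').1
  exact ⟨fun h ⟨e⟩ => DistTough.not_isTough_of_iso hk hτ (by omega) e h,
    DistTough.isTough_of_distLambdaOne_le hk hτ hG hcard hn' hlam⟩
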